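/- Let $n=2^k$ and write $\log$ for $\log_2$. The $n$-input FFT DAG has the nodes $\langle w,l\rangle$ with $0\le w<n$, $0\le l\le \log n$, and an arc from $\langle w,l\rangle$ to $\langle w',l'\rangle$ if and only if $l'=l+1$ and either $w=w'$ or the binary representations of $w$ and $w'$ differ exactly in the $l'$-th least significant bit. Nodes of in-degree $0$ are inputs, nodes of out-degree $0$ are outputs. A BSP has $p$ processors with unbounded local memories and works in supersteps. In a superstep each processor evaluates a sequence of non-input nodes, each from the values of all its predecessors, which must be in the processor's memory at that time, and sends messages to other processors. A message carries at most one node value, which must be in the sender's memory, and becomes visible to the receiver at the beginning of the next superstep. The degree $h_j$ of the $j$-th superstep is the maximum, over all processors, of the number of messages sent or received by the processor, whichever is larger, and the BSP communication complexity of an execution is $H=\sum_j h_j$. Initially the memories contain only values of inputs; holding an input initially counts as evaluating it. An execution evaluates the DAG (possibly with recomputation) if every node is evaluated at least once, by at least one processor. **Theorem.** For every constant $\epsilon>1$ there is a constant $c>0$, depending only on $\epsilon$, such that the following holds for every power of two $n$ and every $p\ge 2$ with $(n/p)\log n\ge 2$. If an execution on a BSP with $p$ processors evaluates the $n$-input FFT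 DAG, possibly with recomputation, each input is initially available to exactly one processor, and no processor evaluates more than $n/\epsilon$ (distinct) outputs, then $$H\;\ge\; c\,\frac{n\log n}{p\,\log\big((n/p)\log n\big)}.$$ -/

import Mathlib

/-- A computation DAG on the node set `V`: `Arc u v` says that the value of `u` is an operand
of `v`. -/
structure ComputationDAG (V : Type) where
  Arc : V → V → Prop
  acyclic : ∀ v, ¬ Relation.TransGen Arc v v

namespace ComputationDAG

variable {V : Type}

/-- Nodes of in-degree zero. -/
def IsInput (G : ComputationDAG V) (v : V) : Prop := ∀ u, ¬ G.Arc u v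

/-- Nodes of out-degree zero. -/
def IsOutput (G : ComputationDAG V) (v : V) : Prop := ∀ u, ¬ G.Arc v u

end ComputationDAG

/-- The arcs of the FFT DAG with `2 ^ k` inputs: `⟨w, l⟩ → ⟨w', l'⟩` iff `l' = l + 1` and either
`w = w'` or the binary representations of `w` and `w'` differ exactly in the `l'`-th least
significant bit. (`Nat.testBit` numbers the bits from `0`, so the `l'`-th least significant
bit is the one with index `b` such that `b + 1 = l'`.) -/
def fftArc (k : ℕ) (x y : Fin (2 ^ k) × Fin (k + 1)) : Prop :=
  (y.2 : ℕ) = (x.2 : ℕ) + 1 ∧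
    (x.1 = y.1 ∨
      ∀ b : ℕ, Nat.testBit (x.1 : ℕ) b ≠ Nat.testBit (y.1 : ℕ) b ↔ b + 1 = (y.2 : ℕ))

theorem fftArc_transGen_lt {k : ℕ} {x y : Fin (2 ^ k) × Fin (k + 1)}
    (h : Relation.TransGen (fftArc k) x y) : (x.2 : ℕ) < (y.2 : ℕ) := by
  induction h with
  | single h => have := h.1; omega
  | tail _ h ih => have := h.1; omega

/-- The FFT DAG with `n = 2 ^ k` inputs: its nodes are the pairs `⟨w, l⟩` with `0 ≤ w < n` and
`0 ≤ l ≤ k = log₂ n`. -/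
def fftDAG (k : ℕ) : ComputationDAG (Fin (2 ^ k) × Fin (k + 1)) where
  Arc := fftArc k
  acyclic := fun _ h => lt_irrefl _ (fftArc_transGen_lt h)

/-- A message of a BSP with `p` processors. It carries the value of one node of the DAG
(`some v`), or data that is not the value of a node (`none`). -/
structure BSPMessage (V : Type) (p : ℕ) where
  src : Fin p
  dst : Fin p
  value : Option V

/-- One superstep: the sequence of nodes evaluated by each processor, in order of time, and the
messages that are sent. Nothing forbids that a node is evaluated several times, by the same
processor or by different ones. -/
structure BSPSuperstep (V : Type) (p : ℕ) where
  work : Fin p → List V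
  msgs : List (BSPMessage V p)

namespace BSPSuperstep

variable {V : Type} {p : ℕ}

/-- The degree of a superstep: the maximum number of messages sent or received by any
processor. -/
def degree (s : BSPSuperstep V p) : ℕ :=
  Finset.univ.sup fun i : Fin p =>
    max (s.msgs.countP fun m => decide (m.src = i)) (s.msgs.countP fun m => decide (m.dst = i))

/-- The node values that are in the local memories (of unbounded size) at the beginning of the
next superstep, if those in `M` are there at the beginning of the superstep `s`. -/
def after (s : BSPSuperstep V p) (M : Fin p → Set V) (i : Fin p) : Set V :=
  {v | v ∈ M i ∨ v ∈ s.work i ∨ ∃ m ∈ s.msgs, m.dst = i ∧ m.value = some v}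

/-- The superstep `s` can be executed when the local memories contain the node values `M`:
every evaluation is a functional operation on operands that the processor has in its memory
at that time, and a node value that is sent to another processor is in the memory of the
sender. Values received during `s` are not yet visible. -/
structure Legal (G : ComputationDAG V) (M : Fin p → Set V) (s : BSPSuperstep V p) : Prop where
  functional : ∀ i, ∀ v ∈ s.work i, ¬ G.IsInput v
  operands : ∀ i pre v post, s.work i = pre ++ v :: post →
    ∀ u, G.Arc u v → u ∈ M i ∨ u ∈ pre
  other : ∀ m ∈ s.msgs, m.src ≠ m.dst
  sender : ∀ m ∈ s.msgs, ∀ v, m.value = some v → v ∈ M m.src ∨ v ∈ s.work m.src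

end BSPSuperstep

/-- The sequence of supersteps can be executed when the local memories initially contain the
node values `M`. -/
def BSPLegal {V : Type} {p : ℕ} (G : ComputationDAG V) :
    (Fin p → Set V) → List (BSPSuperstep V p) → Prop
  | _, [] => True
  | M, s :: ss => s.Legal G M ∧ BSPLegal G (s.after M) ss

/-- An execution of a BSP algorithm with `p` processors, possibly with recomputation. Initially
the memory of processor `i` contains the values of the input nodes in `initial i`. -/
structure BSPExecution {V : Type} (G : ComputationDAG V) (p : ℕ) where
  initial : Fin p → Set V
  steps : List (BSPSuperstep V p)
  initial_isInput : ∀ i, ∀ v ∈ initial i, G.IsInput v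
  legal : BSPLegal G initial steps

namespace BSPExecution

variable {V : Type} {G : ComputationDAG V} {p : ℕ}

/-- Processor `i` evaluates the node `v` at least once: by an input operation, if `v` is an input
that it initially holds, or by a functional operation in some superstep. -/
def EvaluatedBy (A : BSPExecution G p) (i : Fin p) (v : V) : Prop :=
  v ∈ A.initial i ∨ ∃ s ∈ A.steps, v ∈ s.work i

/-- The execution evaluates the DAG: every node is evaluated at least once. -/
def Evaluates (A : BSPExecution G p) : Prop := ∀ v, ∃ i, A.EvaluatedBy i v

/-- The output nodes that processor `i` evaluates. -/
def outputsBy (A : BSPExecution G p) (i : Fin p) : Set V :=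
  {v | G.IsOutput v ∧ A.EvaluatedBy i v}

/-- The BSP communication complexity: the sum of the degrees of the supersteps. -/
def commComplexity (A : BSPExecution G p) : ℕ := (A.steps.map BSPSuperstep.degree).sum

end BSPExecution

/-! Two facts bound the inputs that a processor holds and the nodes that it evaluates. Information
flow: for fixed `s`, the paths from input `w` to output `w ^^^ s` are node-disjoint. If processor
`i` holds `w` but does not evaluate `w ^^^ s`, it must send a value on that path. So at most `H`
such `w` exist for each `s`; averaging over `s` bounds (inputs held) × (outputs not evaluated) by `n
* H` (`ncard_initial_mul_le`). As at least `n (1 - 1/ε)` outputs are missing, `i` holds at most `ε /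
(ε - 1) * H` inputs. Growth: `d` values obtained from outside generate at most `d + 2 d log d`
butterfly nodes (`Butterfly.GeneratedBy.card_le`), and here `d ≤ C * H`. Summing over processors, `n
log n ≤ p * 3 C H log (C H)`, which is then solved for `H`. -/

/-! ### Data flow in a BSP execution. -/

namespace BSPExecution

variable {V : Type} {G : ComputationDAG V} {p : ℕ}

/-- The nodes whose values processor `i` sends in the supersteps `ss`. -/
def sentNodes (ss : List (BSPSuperstep V p)) (i : Fin p) : Set V :=
  {v | ∃ s ∈ ss, ∃ m ∈ s.msgs, m.src = i ∧ m.value = some v}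

/-- The nodes whose values processor `i` receives in the supersteps `ss`. -/
def receivedNodes (ss : List (BSPSuperstep V p)) (i : Fin p) : Set V :=
  {v | ∃ s ∈ ss, ∃ m ∈ s.msgs, m.dst = i ∧ m.value = some v}

/-- The nodes that processor `i` evaluates functionally in the supersteps `ss`. -/
def workNodes (ss : List (BSPSuperstep V p)) (i : Fin p) : Set V :=
  {v | ∃ s ∈ ss, v ∈ s.work i}

theorem ncard_values_le_countP (l : List (BSPMessage V p)) (q : BSPMessage V p → Bool) :
    {v | ∃ m ∈ l, q m = true ∧ m.value = some v}.ncard ≤ l.countP q := by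
  classical
  rw [List.countP_eq_length_filter]
  have hsub : {v | ∃ m ∈ l, q m = true ∧ m.value = some v} ⊆
      (((l.filter q).filterMap BSPMessage.value).toFinset : Set V) := by
    rintro v ⟨m, hm, hq, hv⟩
    simp only [List.coe_toFinset, Set.mem_ofPred_eq, List.mem_filterMap, List.mem_filter]
    exact ⟨m, ⟨hm, hq⟩, hv⟩
  calc _ ≤ (((l.filter q).filterMap BSPMessage.value).toFinset : Set V).ncard :=
        Set.ncard_le_ncard hsub (Finset.finite_toSet _)
    _ ≤ ((l.filter q).filterMap BSPMessage.value).length := by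
        rw [Set.ncard_coe_finset]; exact List.toFinset_card_le _
    _ ≤ _ := List.length_filterMap_le _ _

theorem max_countP_le_degree (s : BSPSuperstep V p) (i : Fin p) :
    max (s.msgs.countP fun m => decide (m.src = i)) (s.msgs.countP fun m => decide (m.dst = i)) ≤
      s.degree :=
  Finset.le_sup (f := fun i : Fin p => max (s.msgs.countP fun m => decide (m.src = i))
    (s.msgs.countP fun m => decide (m.dst = i))) (Finset.mem_univ i)

theorem ncard_sentNodes_le (ss : List (BSPSuperstep V p)) (i : Fin p) :
    (sentNodes ss i).ncard ≤ (ss.map BSPSuperstep.degree).sum := by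
  induction ss with
  | nil => simp [sentNodes]
  | cons s ss ih =>
    have heq : sentNodes (s :: ss) i =
        {v | ∃ m ∈ s.msgs, decide (m.src = i) = true ∧ m.value = some v} ∪ sentNodes ss i := by
      ext v; simp [sentNodes]
    rw [heq, List.map_cons, List.sum_cons]
    refine (Set.ncard_union_le _ _).trans (Nat.add_le_add ?_ ih)
    exact (ncard_values_le_countP _ _).trans ((le_max_left _ _).trans (max_countP_le_degree s i))

theorem ncard_receivedNodes_le (ss : List (BSPSuperstep V p)) (i : Fin p) :
    (receivedNodes ss i).ncard ≤ (ss.map BSPSuperstep.degree).sum := by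
  induction ss with
  | nil => simp [receivedNodes]
  | cons s ss ih =>
    have heq : receivedNodes (s :: ss) i =
        {v | ∃ m ∈ s.msgs, decide (m.dst = i) = true ∧ m.value = some v} ∪
          receivedNodes ss i := by
      ext v; simp [receivedNodes]
    rw [heq, List.map_cons, List.sum_cons]
    refine (Set.ncard_union_le _ _).trans (Nat.add_le_add ?_ ih)
    exact (ncard_values_le_countP _ _).trans ((le_max_right _ _).trans (max_countP_le_degree s i))

/-- If the values on a path are initially in the memory of no processor other than `i`, and `i`
sends none of them, then no other processor evaluates a node of the path. -/
theorem not_mem_work_of_not_sent (i : Fin p) (P : ℕ → V) (K : ℕ)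
    (hP : ∀ l < K, G.Arc (P l) (P (l + 1))) :
    ∀ (ss : List (BSPSuperstep V p)) (M : Fin p → Set V), BSPLegal G M ss → G.IsInput (P 0) →
      (∀ j ≠ i, ∀ l ≤ K, P l ∉ M j) → (∀ l ≤ K, P l ∉ sentNodes ss i) →
      ∀ j ≠ i, ∀ l ≤ K, P l ∉ workNodes ss j
  | [], _, _, _, _, _ => by simp [workNodes]
  | s :: ss, M, hleg, h0, hM, hsent => by
    obtain ⟨hs, hss⟩ := hleg
    -- Induction along the path: evaluating `P (l + 1)` needs `P l` in memory or evaluated earlier,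
    -- and `P 0` is an input, never evaluated functionally.
    have hwork : ∀ j ≠ i, ∀ l ≤ K, P l ∉ s.work j := by
      intro j hj l
      induction l with
      | zero => intro _ h; exact hs.functional j _ h h0
      | succ l ih =>
        intro hl h
        obtain ⟨pre, post, heq⟩ := List.append_of_mem h
        rcases hs.operands j pre _ post heq _ (hP l hl) with h1 | h1
        · exact hM j hj l (by omega) h1
        · exact ih (by omega) (by rw [heq]; exact List.mem_append_left _ h1)
    have hafter : ∀ j ≠ i, ∀ l ≤ K, P l ∉ s.after M j := by
      rintro j hj l hl (h | h | ⟨m, hm, hd, hv⟩)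
      · exact hM j hj l hl h
      · exact hwork j hj l hl h
      · by_cases hi : m.src = i
        · exact hsent l hl ⟨s, by simp, m, hm, hi, hv⟩
        · rcases hs.sender m hm _ hv with h | h
          · exact hM _ hi l hl h
          · exact hwork _ hi l hl h
    have ih := not_mem_work_of_not_sent i P K hP ss _ hss h0 hafter
      (fun l hl ⟨t, ht, h⟩ => hsent l hl ⟨t, by simp [ht], h⟩)
    rintro j hj l hl ⟨t, ht, h⟩
    rcases List.mem_cons.1 ht with rfl | ht
    · exact hwork j hj l hl h
    · exact ih j hj l hl ⟨t, ht, h⟩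

theorem not_isInput_of_mem_workNodes (i : Fin p) {v : V} :
    ∀ (ss : List (BSPSuperstep V p)) (M : Fin p → Set V), BSPLegal G M ss →
      v ∈ workNodes ss i → ¬ G.IsInput v
  | [], _, _, h => by simp [workNodes] at h
  | _ :: ss, _, ⟨hs, hss⟩, ⟨t, ht, h⟩ => by
    rcases List.mem_cons.1 ht with rfl | ht
    · exact hs.functional i v h
    · exact not_isInput_of_mem_workNodes i ss _ hss ⟨t, ht, h⟩

/-- The operands of a functional evaluation are initially present, received or evaluated. -/
theorem operand_mem_of_mem_workNodes (i : Fin p) {u v : V} (huv : G.Arc u v) :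
    ∀ (ss : List (BSPSuperstep V p)) (M : Fin p → Set V), BSPLegal G M ss →
      v ∈ workNodes ss i → u ∈ M i ∪ receivedNodes ss i ∪ workNodes ss i
  | [], _, _, h => by simp [workNodes] at h
  | s :: ss, M, ⟨hs, hss⟩, ⟨t, ht, h⟩ => by
    rcases List.mem_cons.1 ht with rfl | ht
    · obtain ⟨pre, post, heq⟩ := List.append_of_mem h
      rcases hs.operands i pre _ post heq _ huv with h1 | h1
      · exact Or.inl (Or.inl h1)
      · exact Or.inr ⟨t, by simp, by rw [heq]; exact List.mem_append_left _ h1⟩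
    · rcases operand_mem_of_mem_workNodes i huv ss _ hss ⟨t, ht, h⟩ with (h | h) | h
      · rcases h with h | h | ⟨m, hm⟩
        · exact Or.inl (Or.inl h)
        · exact Or.inr ⟨s, by simp, h⟩
        · exact Or.inl (Or.inr ⟨s, by simp, m, hm⟩)
      · obtain ⟨t, ht, h⟩ := h
        exact Or.inl (Or.inr ⟨t, by simp [ht], h⟩)
      · obtain ⟨t, ht, h⟩ := h
        exact Or.inr ⟨t, by simp [ht], h⟩

end BSPExecution

/-! ### Counting generated butterfly nodes, and averaging over translations. -/

namespace Butterfly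

/-- A set `S` of butterfly nodes `(row, level)` is generated by `D` if every node of `S` outside
`D` has both of its predecessors in `S`. -/
structure GeneratedBy (S D : Finset (ℕ × ℕ)) : Prop where
  zero : ∀ w, (w, 0) ∈ S → (w, 0) ∈ D
  straight : ∀ w l, (w, l + 1) ∈ S → (w, l + 1) ∉ D → (w, l) ∈ S
  cross : ∀ w l, (w, l + 1) ∈ S → (w, l + 1) ∉ D → (w ^^^ 2 ^ l, l) ∈ S

/-- The nodes of `S` in the sub-butterfly of height `l` with index `h`. -/
def block (S : Finset (ℕ × ℕ)) (l h : ℕ) : Finset (ℕ × ℕ) :=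
  S.filter fun x => x.2 ≤ l ∧ x.1 / 2 ^ l = h

/-- The rows of the top nodes of `S` in the sub-butterfly of height `l` with index `h`. -/
def top (S : Finset (ℕ × ℕ)) (l h : ℕ) : Finset ℕ :=
  (S.filter fun x => x.2 = l ∧ x.1 / 2 ^ l = h).image Prod.fst

variable {S D : Finset (ℕ × ℕ)}

theorem mem_block {l h : ℕ} {x : ℕ × ℕ} :
    x ∈ block S l h ↔ x ∈ S ∧ x.2 ≤ l ∧ x.1 / 2 ^ l = h := by simp [block]

theorem mem_top {l h w : ℕ} : w ∈ top S l h ↔ (w, l) ∈ S ∧ w / 2 ^ l = h := by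
  simp [top]

theorem GeneratedBy.exists_mem (hS : GeneratedBy S D) (w : ℕ) :
    ∀ l, (w, l) ∈ S → ∃ j ≤ l, (w, j) ∈ D := by
  intro l
  induction l with
  | zero => exact fun h => ⟨0, le_rfl, hS.zero w h⟩
  | succ l ih =>
    intro h
    by_cases hD : (w, l + 1) ∈ D
    · exact ⟨_, le_rfl, hD⟩
    · obtain ⟨j, hj, h'⟩ := ih (hS.straight w l h hD)
      exact ⟨j, by omega, h'⟩

/-- Going down its row, each top node meets `D` inside the block; distinct rows meet distinct nodes
of `D`. -/
theorem GeneratedBy.card_top_le (hS : GeneratedBy S D) (l h : ℕ) :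
    (top S l h).card ≤ (block D l h).card := by
  refine (Finset.card_le_card fun w hw => ?_).trans
    (Finset.card_image_le (s := block D l h) (f := Prod.fst))
  rw [mem_top] at hw
  obtain ⟨j, hj, hD⟩ := hS.exists_mem w l hw.1
  exact Finset.mem_image.2 ⟨(w, j), mem_block.2 ⟨hD, hj, hw.2⟩, rfl⟩

theorem div_two_pow_succ (w l : ℕ) : w / 2 ^ (l + 1) = w / 2 ^ l / 2 := by
  rw [pow_succ, Nat.div_div_eq_div_mul]

theorem xor_two_pow_div (w l : ℕ) : (w ^^^ 2 ^ l) / 2 ^ l = (w / 2 ^ l) ^^^ 1 := by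
  rw [← Nat.shiftRight_eq_div_pow, ← Nat.shiftRight_eq_div_pow, Nat.shiftRight_xor_distrib]
  congr 1
  rw [Nat.shiftRight_eq_div_pow, Nat.div_self (by positivity)]

theorem two_mul_xor_one (h : ℕ) : 2 * h ^^^ 1 = 2 * h + 1 := by
  apply Nat.eq_of_testBit_eq; intro b
  cases b with
  | zero => simp
  | succ b => simp [Nat.testBit_succ]

theorem two_mul_add_one_xor_one (h : ℕ) : (2 * h + 1) ^^^ 1 = 2 * h := by
  rw [← two_mul_xor_one, Nat.xor_assoc]; simp

/-- A node outside `D` has its straight predecessor in the half `g` and its cross predecessor in the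
sibling half `g ^^^ 1`, and both maps are injective. Hence the smaller half limits the new level. -/
theorem GeneratedBy.card_side_le (hS : GeneratedBy S D) (l g : ℕ) :
    (((S \ D).filter fun x => x.2 = l + 1 ∧ x.1 / 2 ^ l = g).card ≤ (top S l g).card) ∧
    (((S \ D).filter fun x => x.2 = l + 1 ∧ x.1 / 2 ^ l = g).card ≤
      (top S l (g ^^^ 1)).card) := by
  constructor
  · refine Finset.card_le_card_of_injOn Prod.fst ?_ ?_
    · rintro ⟨w, j⟩ hx
      simp only [Finset.coe_filter, Finset.mem_sdiff, Set.mem_ofPred_eq] at hx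
      obtain ⟨⟨h1, h2⟩, rfl, h4⟩ := hx
      exact mem_top.2 ⟨hS.straight w l h1 h2, h4⟩
    · rintro ⟨w, j⟩ hx ⟨w', j'⟩ hx' h
      simp only [Finset.coe_filter, Set.mem_ofPred_eq] at hx hx' h
      simp [h, hx.2.1, hx'.2.1]
  · refine Finset.card_le_card_of_injOn (fun x => x.1 ^^^ 2 ^ l) ?_ ?_
    · rintro ⟨w, j⟩ hx
      simp only [Finset.coe_filter, Finset.mem_sdiff, Set.mem_ofPred_eq] at hx
      obtain ⟨⟨h1, h2⟩, rfl, h4⟩ := hx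
      exact mem_top.2 ⟨hS.cross w l h1 h2, by rw [xor_two_pow_div, h4]⟩
    · rintro ⟨w, j⟩ hx ⟨w', j'⟩ hx' h
      simp only [Finset.coe_filter, Set.mem_ofPred_eq] at hx hx' h
      have := Nat.xor_left_injective h
      simp only [Prod.mk.injEq]
      exact ⟨this, by omega⟩

/-- The bound on the number of butterfly nodes that `d` nodes generate. -/
def growth (d : ℕ) : ℕ := d + 2 * d * Nat.log 2 d

theorem growth_mono {a b : ℕ} (h : a ≤ b) : growth a ≤ growth b := by
  have := Nat.log_mono_right (b := 2) h
  unfold growth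
  gcongr

/-- Since `2 * a ≤ a + b`, the logarithm belonging to the smaller part rises by at least one, which
gains `2 * a`. -/
theorem growth_add_le {a b : ℕ} (h : a ≤ b) : growth a + growth b + 2 * a ≤ growth (a + b) := by
  rcases Nat.eq_zero_or_pos a with rfl | ha
  · simp [growth]
  have h1 : Nat.log 2 a + 1 ≤ Nat.log 2 (a + b) := by
    rw [← Nat.log_mul_base (by norm_num) ha.ne']
    exact Nat.log_mono_right (by omega)
  have h2 : Nat.log 2 b ≤ Nat.log 2 (a + b) := Nat.log_mono_right (by omega)
  unfold growth
  nlinarith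

theorem growth_superadd (a b t : ℕ) :
    growth a + growth b + 2 * min a b + t ≤ growth (a + b + t) := by
  have h1 : growth a + growth b + 2 * min a b ≤ growth (a + b) := by
    rcases le_total a b with h | h
    · rw [min_eq_left h]; exact growth_add_le h
    · rw [min_eq_right h, add_comm a b, add_comm (growth a)]; exact growth_add_le h
  have h2 : Nat.log 2 (a + b) ≤ Nat.log 2 (a + b + t) := Nat.log_mono_right (by omega)
  refine (Nat.add_le_add_right h1 t).trans ?_
  unfold growth
  nlinarith

theorem card_block_succ (T : Finset (ℕ × ℕ)) (l h : ℕ) :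
    (block T (l + 1) h).card = (block T l (2 * h)).card + (block T l (2 * h + 1)).card +
      (T.filter fun x => x.2 = l + 1 ∧ x.1 / 2 ^ (l + 1) = h).card := by
  rw [← Finset.card_union_of_disjoint, ← Finset.card_union_of_disjoint]
  · congr 1
    ext x
    simp only [Finset.mem_union, mem_block, Finset.mem_filter, div_two_pow_succ]
    grind
  · rw [Finset.disjoint_left]
    intro x
    simp only [Finset.mem_union, mem_block, Finset.mem_filter]
    grind
  · rw [Finset.disjoint_left]
    intro x
    simp only [mem_block]
    grind

/-- Induction on the height. A block is two sub-butterflies plus one level; on that level the nodes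
outside `D` are paid for by the term `2 * min a b` of `growth_superadd`, those in `D` by `t`. -/
theorem GeneratedBy.card_block_le (hS : GeneratedBy S D) :
    ∀ l h, (block S l h).card ≤ growth (block D l h).card := by
  intro l
  induction l with
  | zero =>
    intro h
    refine le_trans (Finset.card_le_card ?_) (Nat.le_add_right _ _)
    rintro ⟨w, j⟩ hx
    rw [mem_block] at hx ⊢
    obtain ⟨h1, h2, h3⟩ := hx
    obtain rfl : j = 0 := by simpa using h2
    exact ⟨hS.zero w h1, h2, h3⟩
  | succ l ih =>
    intro h
    rw [card_block_succ S, card_block_succ D]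
    refine le_trans ?_ (growth_superadd _ _ _)
    have e := hS.card_side_le l (2 * h)
    have o := hS.card_side_le l (2 * h + 1)
    rw [two_mul_xor_one] at e
    rw [two_mul_add_one_xor_one] at o
    have te := hS.card_top_le l (2 * h)
    have te' := hS.card_top_le l (2 * h + 1)
    have hsplit : (S.filter fun x => x.2 = l + 1 ∧ x.1 / 2 ^ (l + 1) = h).card ≤
        ((S \ D).filter fun x => x.2 = l + 1 ∧ x.1 / 2 ^ l = 2 * h).card +
        ((S \ D).filter fun x => x.2 = l + 1 ∧ x.1 / 2 ^ l = 2 * h + 1).card +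
        (D.filter fun x => x.2 = l + 1 ∧ x.1 / 2 ^ (l + 1) = h).card := by
      refine le_trans (Finset.card_le_card ?_) ((Finset.card_union_le _ _).trans
        (Nat.add_le_add_right (Finset.card_union_le _ _) _))
      intro x
      simp only [Finset.mem_union, Finset.mem_filter, Finset.mem_sdiff, div_two_pow_succ]
      grind
    have := ih (2 * h)
    have := ih (2 * h + 1)
    omega

/-- A set of butterfly nodes generated by `d` nodes has at most `d + 2 d log₂ d` elements, if its
rows and levels are bounded. -/
theorem GeneratedBy.card_le (hS : GeneratedBy S D) {k : ℕ}
    (hk : ∀ x ∈ S, x.1 < 2 ^ k ∧ x.2 ≤ k) : S.card ≤ growth D.card := by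
  have h1 : block S k 0 = S := by
    refine Finset.filter_true_of_mem fun x hx => ⟨(hk x hx).2, Nat.div_eq_of_lt (hk x hx).1⟩
  calc S.card = (block S k 0).card := by rw [h1]
    _ ≤ growth (block D k 0).card := hS.card_block_le k 0
    _ ≤ growth D.card := growth_mono (Finset.card_filter_le _ _)

/-- Averaging over all exclusive-or translations. -/
theorem card_mul_card_le_of_xor {k H : ℕ} {X Y : Finset ℕ} (hX : ∀ x ∈ X, x < 2 ^ k)
    (hY : ∀ y ∈ Y, y < 2 ^ k)
    (h : ∀ s < 2 ^ k, (X.filter fun w => w ^^^ s ∈ Y).card ≤ H) :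
    X.card * Y.card ≤ 2 ^ k * H := by
  calc X.card * Y.card = ∑ _w ∈ X, Y.card := by simp
    -- Each pair `(w, y)` is counted at the translation `s = w ^^^ y`.
    _ ≤ ∑ w ∈ X, ((Finset.range (2 ^ k)).filter fun s => w ^^^ s ∈ Y).card := by
        refine Finset.sum_le_sum fun w hw => ?_
        refine Finset.card_le_card_of_injOn (fun y => w ^^^ y) (fun y hy => ?_)
          (fun a _ b _ hab => Nat.xor_right_injective hab)
        simp only [Finset.coe_filter, Finset.mem_range, Set.mem_ofPred_eq]
        refine ⟨Nat.xor_lt_two_pow (hX w hw) (hY y hy), ?_⟩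
        rw [← Nat.xor_assoc]; simpa using hy
    _ = ∑ s ∈ Finset.range (2 ^ k), (X.filter fun w => w ^^^ s ∈ Y).card := by
        simp only [Finset.card_filter]
        exact Finset.sum_comm
    _ ≤ ∑ _s ∈ Finset.range (2 ^ k), H :=
        Finset.sum_le_sum fun s hs => h s (Finset.mem_range.1 hs)
    _ = _ := by simp

end Butterfly

/-! ### Arcs and translation paths of the FFT DAG. -/

section FFT

variable {k : ℕ}

theorem fftDAG_arc_straight (w : Fin (2 ^ k)) (l : ℕ) (hl : l + 1 < k + 1) :
    (fftDAG k).Arc (w, ⟨l, by omega⟩) (w, ⟨l + 1, hl⟩) := ⟨rfl, Or.inl rfl⟩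

theorem fftDAG_arc_cross (w w' : Fin (2 ^ k)) (l : ℕ) (hl : l + 1 < k + 1)
    (h : (w' : ℕ) = (w : ℕ) ^^^ 2 ^ l) :
    (fftDAG k).Arc (w', ⟨l, by omega⟩) (w, ⟨l + 1, hl⟩) := by
  refine ⟨rfl, Or.inr fun b => ?_⟩
  simp only [h, Nat.testBit_xor, Nat.testBit_two_pow]
  by_cases hb : l = b <;> simp [hb]; omega

theorem fftDAG_isInput_iff (v : Fin (2 ^ k) × Fin (k + 1)) :
    (fftDAG k).IsInput v ↔ (v.2 : ℕ) = 0 := by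
  constructor
  · rintro h
    obtain ⟨w, l, hl⟩ := v
    cases l with
    | zero => rfl
    | succ l => exact absurd (fftDAG_arc_straight w l hl) (h _)
  · intro h u hu
    have := hu.1
    omega

theorem fftDAG_isOutput_of_eq (v : Fin (2 ^ k) × Fin (k + 1)) (h : (v.2 : ℕ) = k) :
    (fftDAG k).IsOutput v := by
  intro u hu
  have := hu.1
  have := u.2.2
  omega

/-- The path from the input `w` to the output `w ^^^ s`. -/
def xorPath (w s : ℕ) (hw : w < 2 ^ k) (hs : s < 2 ^ k) (l : ℕ) : Fin (2 ^ k) × Fin (k + 1) :=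
  (⟨w ^^^ s % 2 ^ l, Nat.xor_lt_two_pow hw ((Nat.mod_le _ _).trans_lt hs)⟩,
    ⟨min l k, by omega⟩)

/-- Bit `l` of `s` decides between the cross and the straight arc. -/
theorem xorPath_arc {w s : ℕ} (hw : w < 2 ^ k) (hs : s < 2 ^ k) {l : ℕ} (hl : l < k) :
    (fftDAG k).Arc (xorPath w s hw hs l) (xorPath w s hw hs (l + 1)) := by
  refine ⟨by simp only [xorPath]; omega, ?_⟩
  simp only [xorPath, Fin.mk.injEq]
  by_cases hb : s.testBit l
  · right
    intro b
    simp only [Nat.testBit_xor, Nat.testBit_mod_two_pow]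
    rw [min_eq_left (by omega)]
    rcases lt_trichotomy b l with h | rfl | h
    · simp [h, show b < l + 1 by omega]; omega
    · simp [hb]
    · simp [show ¬ b < l by omega, show ¬ b < l + 1 by omega]; omega
  · left
    congr 1
    apply Nat.eq_of_testBit_eq
    intro b
    simp only [Nat.testBit_mod_two_pow]
    rcases lt_trichotomy b l with h | rfl | h
    · simp [h, show b < l + 1 by omega]
    · simp [hb]
    · simp [show ¬ b < l by omega, show ¬ b < l + 1 by omega]

end FFT

/-! ### Bounds for a single processor, and the node count. -/

namespace BSPExecution

variable {k p : ℕ} (A : BSPExecution (fftDAG k) p)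

/-- Every translation path from an input held by `i` to an output that `i` does not evaluate
contains a node sent by `i`. -/
theorem exists_mem_sentNodes (hA : A.Evaluates)
    (hin : ∀ v, (fftDAG k).IsInput v → ∃! i, v ∈ A.initial i) (i : Fin p) {w s : ℕ}
    (hw : w < 2 ^ k) (hs : s < 2 ^ k) (h0 : xorPath w s hw hs 0 ∈ A.initial i)
    (hk : ¬ A.EvaluatedBy i (xorPath w s hw hs k)) :
    ∃ l ≤ k, xorPath w s hw hs l ∈ sentNodes A.steps i := by
  by_contra! hcon
  obtain ⟨j, hj⟩ := hA (xorPath w s hw hs k)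
  have hji : j ≠ i := fun h => hk (h ▸ hj)
  have hM : ∀ j ≠ i, ∀ l ≤ k, xorPath w s hw hs l ∉ A.initial j := by
    intro j hj l hl hmem
    have hinp := A.initial_isInput j _ hmem
    have hl0 := (fftDAG_isInput_iff _).1 hinp
    simp only [xorPath] at hl0
    obtain rfl : l = 0 := by omega
    exact hj ((hin _ hinp).unique hmem h0)
  rcases hj with hj | hj
  · exact hM j hji k le_rfl hj
  · refine not_mem_work_of_not_sent i (xorPath w s hw hs) k (fun l hl => xorPath_arc hw hs hl)
      A.steps A.initial A.legal ?_ hM hcon j hji k le_rfl hj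
    rw [fftDAG_isInput_iff]; simp [xorPath]

/-- Information flow: a processor that holds many inputs sends many messages, unless it
evaluates almost all outputs. -/
theorem ncard_initial_mul_le (hA : A.Evaluates)
    (hin : ∀ v, (fftDAG k).IsInput v → ∃! i, v ∈ A.initial i) (i : Fin p) :
    (A.initial i).ncard * (2 ^ k - (A.outputsBy i).ncard) ≤ 2 ^ k * A.commComplexity := by
  classical
  let row : Fin (2 ^ k) × Fin (k + 1) → ℕ := fun v => v.1
  let X : Finset ℕ := (A.initial i).toFinset.image row
  let Z : Finset ℕ := (A.outputsBy i).toFinset.image row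
  let Y : Finset ℕ := Finset.range (2 ^ k) \ Z
  have hXcard : X.card = (A.initial i).ncard := by
    rw [Set.ncard_eq_toFinset_card']
    refine Finset.card_image_of_injOn ?_
    rintro ⟨a, b⟩ hx ⟨c, d⟩ hy h
    have h1 := (fftDAG_isInput_iff _).1 (A.initial_isInput i _ (Set.mem_toFinset.1 hx))
    have h2 := (fftDAG_isInput_iff _).1 (A.initial_isInput i _ (Set.mem_toFinset.1 hy))
    exact Prod.ext (Fin.ext h) (Fin.ext (h1.trans h2.symm))
  have hYcard : 2 ^ k - (A.outputsBy i).ncard ≤ Y.card := by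
    have h1 : Z.card ≤ (A.outputsBy i).ncard := by
      rw [Set.ncard_eq_toFinset_card']; exact Finset.card_image_le
    have h2 := Finset.le_card_sdiff Z (Finset.range (2 ^ k))
    rw [Finset.card_range] at h2
    exact (Nat.sub_le_sub_left h1 _).trans h2
  have hX : ∀ x ∈ X, x < 2 ^ k := by
    intro x hx
    obtain ⟨v, _, rfl⟩ := Finset.mem_image.1 hx
    exact v.1.2
  have hY : ∀ y ∈ Y, y < 2 ^ k := fun y hy => Finset.mem_range.1 (Finset.mem_sdiff.1 hy).1
  rw [← hXcard]
  refine (Nat.mul_le_mul_left _ hYcard).trans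
    (Butterfly.card_mul_card_le_of_xor hX hY fun s hs => ?_)
  refine le_trans ?_ (ncard_sentNodes_le A.steps i)
  rw [Set.ncard_eq_toFinset_card']
  -- This map recovers `w` from any node of its path, so a sent node serves only one `w`.
  refine le_trans (Finset.card_le_card ?_) (Finset.card_image_le
    (f := fun v : Fin (2 ^ k) × Fin (k + 1) => (v.1 : ℕ) ^^^ s % 2 ^ (v.2 : ℕ)))
  intro w hw
  obtain ⟨hwX, hwY⟩ := Finset.mem_filter.1 hw
  have hwk := hX w hwX
  obtain ⟨l, hl, hmem⟩ := A.exists_mem_sentNodes hA hin i hwk hs (by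
      obtain ⟨v, hv, hvw⟩ := Finset.mem_image.1 hwX
      have hv := Set.mem_toFinset.1 hv
      have h0 := (fftDAG_isInput_iff _).1 (A.initial_isInput i _ hv)
      convert hv
      refine Prod.ext (Fin.ext ?_) (Fin.ext ?_)
      · simp [xorPath, Nat.mod_one, ← hvw, row]
      · simp [xorPath, h0]) (by
      intro hev
      refine (Finset.mem_sdiff.1 hwY).2 (Finset.mem_image.2
        ⟨xorPath w s hwk hs k, Set.mem_toFinset.2 ⟨fftDAG_isOutput_of_eq _ ?_, hev⟩, ?_⟩)
      · simp [xorPath]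
      · simp [xorPath, row, Nat.mod_eq_of_lt hs])
  refine Finset.mem_image.2 ⟨_, Set.mem_toFinset.2 hmem, ?_⟩
  simp only [xorPath, min_eq_left hl]
  rw [Nat.xor_assoc, Nat.xor_self, Nat.xor_zero]

/-- The number of nodes that a processor evaluates is bounded in terms of the number of values
that it obtains from outside. -/
theorem ncard_evaluatedBy_le (i : Fin p) :
    {v | A.EvaluatedBy i v}.ncard ≤
      Butterfly.growth ((A.initial i).ncard + A.commComplexity) := by
  classical
  let f : Fin (2 ^ k) × Fin (k + 1) → ℕ × ℕ := fun v => (v.1, v.2)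
  have hf : Function.Injective f := by
    rintro ⟨a, b⟩ ⟨c, d⟩ h
    simp only [f, Prod.mk.injEq] at h
    exact Prod.ext (Fin.ext h.1) (Fin.ext h.2)
  -- The order of time is forgotten: all values from outside form `D'`, and only the closure of `S'`
  -- under operands matters.
  let D' := A.initial i ∪ receivedNodes A.steps i
  let S' := D' ∪ workNodes A.steps i
  obtain ⟨D, hDdef⟩ : ∃ D, D = D'.toFinset.image f := ⟨_, rfl⟩
  obtain ⟨S, hSdef⟩ : ∃ S, S = S'.toFinset.image f := ⟨_, rfl⟩
  have memS : ∀ v, f v ∈ S ↔ v ∈ S' := fun v => by simp [hSdef, hf.eq_iff]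
  have memD : ∀ v, f v ∈ D ↔ v ∈ D' := fun v => by simp [hDdef, hf.eq_iff]
  have pred : ∀ u v, (fftDAG k).Arc u v → f v ∈ S → f v ∉ D → f u ∈ S := by
    intro u v huv hS hD
    rw [memS] at hS ⊢
    rw [memD] at hD
    exact operand_mem_of_mem_workNodes i huv A.steps A.initial A.legal (hS.resolve_left hD)
  have hb : ∀ x ∈ S, x.1 < 2 ^ k ∧ x.2 < k + 1 := by
    intro x hx
    obtain ⟨v, _, rfl⟩ := Finset.mem_image.1 (hSdef ▸ hx)
    exact ⟨v.1.2, v.2.2⟩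
  have hgen : Butterfly.GeneratedBy S D := by
    refine ⟨fun w h => ?_, fun w l h hD => ?_, fun w l h hD => ?_⟩
    · obtain ⟨hw, h0⟩ := hb _ h
      have hm := (memS (⟨w, hw⟩, ⟨0, h0⟩)).1 h
      refine (memD (⟨w, hw⟩, ⟨0, h0⟩)).2 (hm.resolve_right ?_)
      intro hwork
      exact not_isInput_of_mem_workNodes i A.steps A.initial A.legal hwork
        ((fftDAG_isInput_iff _).2 rfl)
    · obtain ⟨hw, hl⟩ := hb _ h
      exact pred (⟨w, hw⟩, ⟨l, by omega⟩) (⟨w, hw⟩, ⟨l + 1, hl⟩)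
        (fftDAG_arc_straight ⟨w, hw⟩ l hl) h hD
    · obtain ⟨hw, hl⟩ := hb _ h
      have hw' : w ^^^ 2 ^ l < 2 ^ k :=
        Nat.xor_lt_two_pow hw (Nat.pow_lt_pow_right (by norm_num) (by omega))
      exact pred (⟨w ^^^ 2 ^ l, hw'⟩, ⟨l, by omega⟩) (⟨w, hw⟩, ⟨l + 1, hl⟩)
        (fftDAG_arc_cross ⟨w, hw⟩ ⟨_, hw'⟩ l hl rfl) h hD
  have hcard := hgen.card_le (k := k) fun x hx => ⟨(hb x hx).1, Nat.le_of_lt_succ (hb x hx).2⟩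
  have hD : D.card ≤ (A.initial i).ncard + A.commComplexity := by
    rw [hDdef]
    refine Finset.card_image_le.trans ?_
    rw [← Set.ncard_eq_toFinset_card']
    exact (Set.ncard_union_le _ _).trans
      (Nat.add_le_add_left (ncard_receivedNodes_le A.steps i) _)
  refine le_trans ?_ (hcard.trans (Butterfly.growth_mono hD))
  rw [hSdef, Finset.card_image_of_injective _ hf, ← Set.ncard_eq_toFinset_card']
  refine Set.ncard_le_ncard ?_
  rintro v (h | h)
  · exact Or.inl (Or.inl h)
  · exact Or.inr h

theorem card_nodes_le (hA : A.Evaluates) :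
    2 ^ k * (k + 1) ≤
      ∑ i, Butterfly.growth ((A.initial i).ncard + A.commComplexity) := by
  classical
  have h1 : (Finset.univ : Finset (Fin (2 ^ k) × Fin (k + 1))) ⊆
      Finset.univ.biUnion fun i => {v | A.EvaluatedBy i v}.toFinset := by
    intro v _
    obtain ⟨i, hi⟩ := hA v
    exact Finset.mem_biUnion.2 ⟨i, Finset.mem_univ i, Set.mem_toFinset.2 hi⟩
  have h2 := (Finset.card_le_card h1).trans Finset.card_biUnion_le
  rw [Finset.card_univ, Fintype.card_prod, Fintype.card_fin, Fintype.card_fin] at h2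
  refine h2.trans (Finset.sum_le_sum fun i _ => ?_)
  rw [← Set.ncard_eq_toFinset_card']
  exact A.ncard_evaluatedBy_le i

end BSPExecution

/-! ### Real estimates and the final bound. -/

theorem Butterfly.growth_le_logb {d : ℕ} {Y : ℝ} (hY : 2 ≤ Y) (hd : (d : ℝ) ≤ Y) :
    (Butterfly.growth d : ℝ) ≤ 3 * Y * Real.logb 2 Y := by
  have hlogY : 1 ≤ Real.logb 2 Y := by
    rw [Real.le_logb_iff_rpow_le (by norm_num) (by linarith)]; simpa using hY
  have hlog : (Nat.log 2 d : ℝ) ≤ Real.logb 2 Y := by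
    rcases Nat.eq_zero_or_pos d with rfl | hpos
    · simp; linarith
    · have h1 : (Nat.log 2 d : ℝ) ≤ Real.logb 2 d := by
        exact_mod_cast Real.natLog_le_logb d 2
      exact h1.trans (Real.logb_le_logb_of_le (by norm_num) (by exact_mod_cast hpos) hd)
  have h2 : (d : ℝ) * (Nat.log 2 d : ℝ) ≤ Y * Real.logb 2 Y := by gcongr
  have h3 : Y ≤ Y * Real.logb 2 Y := le_mul_of_one_le_right (by linarith) hlogY
  unfold Butterfly.growth
  push_cast
  linarith

/-- Inversion of `X ≤ 3 Y log Y`. -/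
theorem div_logb_le_of_le_mul_logb {X Y : ℝ} (hX : 2 ≤ X) (hY : 0 < Y)
    (h : X ≤ 3 * Y * Real.logb 2 Y) : X / Real.logb 2 X ≤ 3 * Y := by
  have hlogX : 1 ≤ Real.logb 2 X := by
    rw [Real.le_logb_iff_rpow_le (by norm_num) (by linarith)]; simpa using hX
  rw [div_le_iff₀ (by linarith)]
  rcases le_total X Y with hXY | hXY
  · nlinarith
  · have := Real.logb_le_logb_of_le (b := 2) (by norm_num) hY hXY
    exact h.trans (by gcongr)

theorem mainTheorem7 (ε : ℝ) (hε : 1 < ε) :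
    ∃ c : ℝ, 0 < c ∧
      ∀ (n k p : ℕ), n = 2 ^ k → 2 ≤ p →
        2 ≤ ((n : ℝ) / p) * Real.logb 2 n →
        ∀ A : BSPExecution (fftDAG k) p,
          A.Evaluates →
          (∀ v, (fftDAG k).IsInput v → ∃! i, v ∈ A.initial i) →
          (∀ i, ((A.outputsBy i).ncard : ℝ) ≤ (n : ℝ) / ε) →
          c * (((n : ℝ) * Real.logb 2 n) /
              ((p : ℝ) * Real.logb 2 (((n : ℝ) / p) * Real.logb 2 n))) ≤
            (A.commComplexity : ℝ) := by
  -- The summand `1` accounts for received values, `ε / (ε - 1)` for inputs held.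
  set C : ℝ := 1 + ε / (ε - 1) with hC
  have hε' : 0 < ε - 1 := by linarith
  have hC2 : 2 ≤ C := by
    have : 1 ≤ ε / (ε - 1) := by rw [le_div_iff₀ hε']; linarith
    linarith
  refine ⟨1 / (3 * C), by positivity, ?_⟩
  intro n k p hn hp hX A hA hin hout
  have hn0 : (0 : ℝ) < n := by rw [hn]; positivity
  have hp0 : (0 : ℝ) < p := by exact_mod_cast (by omega : 0 < p)
  have hlogn : Real.logb 2 n = k := by
    rw [hn]; push_cast
    rw [← Real.rpow_natCast, Real.logb_rpow (by norm_num) (by norm_num)]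
  set H : ℝ := (A.commComplexity : ℝ) with hH
  have hd : ∀ i, (((A.initial i).ncard + A.commComplexity : ℕ) : ℝ) ≤ C * H := by
    intro i
    have h1 : (A.initial i).ncard * (n - (A.outputsBy i).ncard) ≤ n * A.commComplexity := by
      simpa only [hn] using A.ncard_initial_mul_le hA hin i
    have h2 : ((A.initial i).ncard : ℝ) * ((n : ℝ) - (A.outputsBy i).ncard) ≤ n * H := by
      calc _ ≤ ((A.initial i).ncard : ℝ) * ((n - (A.outputsBy i).ncard : ℕ) : ℝ) := by
            gcongr
            rw [sub_le_iff_le_add]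
            exact_mod_cast le_tsub_add
        _ ≤ _ := by rw [hH]; exact_mod_cast h1
    have h3 : ((A.initial i).ncard : ℝ) * (n - n / ε) ≤ n * H :=
      h2.trans' (by gcongr; exact hout i)
    have h4 : ((A.initial i).ncard : ℝ) ≤ ε / (ε - 1) * H := by
      have e : (n : ℝ) - n / ε = n * ((ε - 1) / ε) := by field_simp
      rw [e, mul_left_comm] at h3
      have h5 := le_of_mul_le_mul_left h3 hn0
      rw [mul_div_assoc', div_le_iff₀ (by linarith)] at h5
      rw [div_mul_eq_mul_div, le_div_iff₀ hε']
      linarith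
    push_cast
    rw [hC]
    linarith
  have hcard := A.card_nodes_le hA
  -- With `H = 0` no processor would hold an input, and `growth 0 = 0` contradicts the node count.
  -- Positivity gives `2 ≤ C * H`, needed for the logarithm.
  have hHpos : 0 < A.commComplexity := by
    rcases Nat.eq_zero_or_pos A.commComplexity with h0 | h0
    · exfalso
      have : ∀ i, (A.initial i).ncard + A.commComplexity = 0 := by
        intro i
        have := hd i
        rw [hH, h0] at this
        simp only [Nat.cast_zero, mul_zero] at this
        rw [h0]
        exact_mod_cast le_antisymm this (by positivity)
      simp [this, Butterfly.growth] at hcard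
    · exact h0
  have hH1 : 1 ≤ H := by rw [hH]; exact_mod_cast hHpos
  have hY : 2 ≤ C * H := by nlinarith
  have hsum : (n : ℝ) * k ≤ p * (3 * (C * H) * Real.logb 2 (C * H)) := by
    calc (n : ℝ) * k ≤ ((2 ^ k * (k + 1) : ℕ) : ℝ) := by
          rw [hn]; push_cast; gcongr; linarith
      _ ≤ ((∑ i, Butterfly.growth ((A.initial i).ncard + A.commComplexity) : ℕ) : ℝ) := by
          exact_mod_cast hcard
      _ ≤ ∑ _i : Fin p, 3 * (C * H) * Real.logb 2 (C * H) := by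
          rw [Nat.cast_sum]
          exact Finset.sum_le_sum fun i _ => Butterfly.growth_le_logb hY (hd i)
      _ = _ := by simp
  have hmain := div_logb_le_of_le_mul_logb hX (by linarith : 0 < C * H) (by
    rw [hlogn, div_mul_eq_mul_div, div_le_iff₀ hp0]; linarith)
  have e : (n : ℝ) * Real.logb 2 n / (p * Real.logb 2 ((n : ℝ) / p * Real.logb 2 n)) =
      (n : ℝ) / p * Real.logb 2 n / Real.logb 2 ((n : ℝ) / p * Real.logb 2 n) := by
    rw [← div_div, div_mul_eq_mul_div]
  rw [e, one_div_mul_eq_div, div_le_iff₀ (by positivity)]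
  linarith
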